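/- All graphs are finite and simple, and graphs are counted up to isomorphism. A graph $G$ is *$(2,1)$-polar* if its vertex set has a partition $(A,B)$ (one of the two sets may be empty) such that $G[A]$ is a complete multipartite graph with at most two parts and $G[B]$ is a complete graph (a $1$-cluster); it is a *minimal $(2,1)$-polar obstruction* if it is not $(2,1)$-polar but every proper induced subgraph of it is. Let $P_4$ denote the path on four vertices. $G$ is *$P_4$-extendible* if for every vertex set $W$ inducing a $P_4$ there is at most one vertex $v\notin W$ that belongs to an induced $P_4$ of $G$ sharing at least one vertex with $W$. $G$ is *$P_4$-sparse* if every set of at most five vertices induces at most one $P_4$. Write $+$ for disjoint union, $\oplus$ for join, $\overline{G}$ for the complement, $K_n$, $C_n$, $P_n$ for the complete graph, the cycle and the path on $n$ vertices, $W_4 = C_4\oplus K_1$, and let $P$ (the banner) be the graph obtained from $C_4$ by attaching one pendant vertex to one of its vertices. Let $$E_1=K_1+2K_2,\quad E_2=2P_3,\quad E_3=C_4+2K_1,\quad E_4=\overline{3K_2},\quad E_5=\overline{K_2+C_4},$$ $$E_6=K_1+W_4,\quad E_7=K_1+\overline{P_3+K_2},\quad E_8=K_2+(K_2\oplus 2K_1),\quad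 E_9=2K_3,$$ $$E_{10}=K_1+C_5,\quad E_{11}=K_1+P,\quad E_{12}=K_1+\overline{P_5},\quad E_{13}=\overline{K_2+C_5}.$$ Then: 1. The graphs $E_1,\dots,E_{13}$ are pairwise non-isomorphic, and a graph is a $P_4$-extendible minimal $(2,1)$-polar obstruction if and only if it is isomorphic to one of them. Thus there are exactly $13$ $P_4$-extendible minimal $(2,1)$-polar obstructions. 2. A graph is a $P_4$-sparse minimal $(2,1)$-polar obstruction if and only if it is isomorphic to one of $E_1,\dots,E_9$. Thus there are exactly nine $P_4$-sparse minimal $(2,1)$-polar obstructions. -/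

import Mathlib

namespace PolarObstruction

open SimpleGraph

/-- `G` is complete multipartite with at most `s` parts: its vertices can be distributed into `s`
(possibly empty) classes such that two vertices are adjacent exactly when their classes differ. -/
def IsCompleteMultipartiteAtMost {V : Type*} (G : SimpleGraph V) (s : ℕ) : Prop :=
  ∃ c : V → Fin s, ∀ u v, G.Adj u v ↔ c u ≠ c v

/-- `G` is a `k`-cluster: the complement of a complete multipartite graph with at most `k` parts. -/
def IsCluster {V : Type*} (G : SimpleGraph V) (k : ℕ) : Prop :=
  IsCompleteMultipartiteAtMost Gᶜ k

/-- `G` is `(s, k)`-polar: its vertex set has a partition `(A, B)`, here with `B = Aᶜ`, such that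
`G[A]` is complete multipartite with at most `s` parts and `G[B]` is a `k`-cluster. -/
def IsPolar {V : Type*} (G : SimpleGraph V) (s k : ℕ) : Prop :=
  ∃ A : Set V, IsCompleteMultipartiteAtMost (G.induce A) s ∧ IsCluster (G.induce Aᶜ) k

/-- `G` is a minimal `(s, k)`-polar obstruction: it is not `(s, k)`-polar, but every proper
induced subgraph of it is. -/
def IsMinimalPolarObstruction {V : Type*} (G : SimpleGraph V) (s k : ℕ) : Prop :=
  ¬ IsPolar G s k ∧ ∀ S : Set V, S ≠ Set.univ → IsPolar (G.induce S) s k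

/-- The vertex set `W` induces a `P₄` (the path on four vertices) in `G`. -/
def InducesP4 {V : Type*} (G : SimpleGraph V) (W : Set V) : Prop :=
  Nonempty (G.induce W ≃g pathGraph 4)

/-- `G` is `P₄`-sparse: every set of at most five vertices induces at most one `P₄`. -/
def IsP4Sparse {V : Type*} (G : SimpleGraph V) : Prop :=
  ∀ U : Finset V, U.card ≤ 5 → {W : Set V | W ⊆ U ∧ InducesP4 G W}.Subsingleton

/-- `G` is `P₄`-extendible: for every vertex set `W` inducing a `P₄` there is at most one vertex
outside `W` that belongs to a `P₄` sharing vertices with `W`. -/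
def IsP4Extendible {V : Type*} (G : SimpleGraph V) : Prop :=
  ∀ W : Set V, InducesP4 G W →
    {v : V | v ∉ W ∧ ∃ W' : Set V, InducesP4 G W' ∧ v ∈ W' ∧ (W' ∩ W).Nonempty}.Subsingleton

/-- The join of two graphs (the disjoint union is Mathlib's `G ⊕g H`). -/
def join {V W : Type*} (G : SimpleGraph V) (H : SimpleGraph W) : SimpleGraph (V ⊕ W) :=
  (Gᶜ ⊕g Hᶜ)ᶜ

/-- The complete graph `Kₙ`. -/
abbrev K (n : ℕ) : SimpleGraph (Fin n) := completeGraph (Fin n)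

/-- The graph `nK₁` with `n` vertices and no edges. -/
abbrev edgeless (n : ℕ) : SimpleGraph (Fin n) := emptyGraph (Fin n)

/-- The banner `P`: the four-cycle `0123` with a pendant vertex `4` attached to `2`. -/
def banner : SimpleGraph (Fin 5) :=
  fromEdgeSet {s(0, 1), s(1, 2), s(2, 3), s(3, 0), s(2, 4)}

/-- `K₁ + 2K₂` -/
def E1 := K 1 ⊕g (K 2 ⊕g K 2)
/-- `2P₃` -/
def E2 := pathGraph 3 ⊕g pathGraph 3
/-- `C₄ + 2K₁` -/
def E3 := cycleGraph 4 ⊕g edgeless 2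
/-- The complement of `3K₂` -/
def E4 := (K 2 ⊕g (K 2 ⊕g K 2))ᶜ
/-- The complement of `K₂ + C₄` -/
def E5 := (K 2 ⊕g cycleGraph 4)ᶜ
/-- `K₁ + W₄`, where the wheel `W₄` is the join of `C₄` and `K₁` -/
def E6 := K 1 ⊕g join (cycleGraph 4) (K 1)
/-- The disjoint union of `K₁` and the complement of `P₃ + K₂` -/
def E7 := K 1 ⊕g (pathGraph 3 ⊕g K 2)ᶜ
/-- The disjoint union of `K₂` and the join of `K₂` and `2K₁` -/
def E8 := K 2 ⊕g join (K 2) (edgeless 2)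
/-- `2K₃` -/
def E9 := K 3 ⊕g K 3
/-- `K₁ + C₅` -/
def E10 := K 1 ⊕g cycleGraph 5
/-- `K₁ + P`, with `P` the banner -/
def E11 := K 1 ⊕g banner
/-- The disjoint union of `K₁` and the complement of `P₅` (the house) -/
def E12 := K 1 ⊕g (pathGraph 5)ᶜ
/-- The complement of `K₂ + C₅` -/
def E13 := (K 2 ⊕g cycleGraph 5)ᶜ

/-- The list `E₁, …, E₁₃`, each graph bundled with its vertex type; the entry with index `i` is
`Eᵢ₊₁`, as indices start at `0`. -/
def E : Fin 13 → Σ V : Type, SimpleGraph V :=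
  ![⟨_, E1⟩, ⟨_, E2⟩, ⟨_, E3⟩, ⟨_, E4⟩, ⟨_, E5⟩, ⟨_, E6⟩, ⟨_, E7⟩, ⟨_, E8⟩, ⟨_, E9⟩,
    ⟨_, E10⟩, ⟨_, E11⟩, ⟨_, E12⟩, ⟨_, E13⟩]

end PolarObstruction

namespace PolarObstruction

/-! ### A certified search -/

/-! A `(2, 1)`-polar partition is a labelling of the vertices by roles with every pair of distinct
vertices compatible. Both `P₄` hypotheses imply `IsTidy`: at most one vertex outside an induced path
lies on an induced path with three of its vertices. So both classifications follow from
`IsMinimalPolarObstruction.exists_hasTriangle`, which finds one of the thirteen graphs in every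
finite tidy minimal obstruction.

Let `G` be such a graph and `v` a vertex. As `G - v` is polar, there is a labelling `L` in which
exactly `v` is free; take one with the largest clique. Then every vertex outside the clique, `v`
included, misses some clique vertex, since otherwise it could be moved into the clique. A search
reveals `G` vertex by vertex from `v`, always with a reason for a new vertex to exist. If a revealed
non-clique vertex is adjacent to all revealed clique vertices, maximality yields an unrevealed
clique vertex that it misses. If there is none such, take a polar labelling `q` of the revealed
part: some unrevealed vertex must conflict with `q`, or else gluing `q` to `L` would make `G` polar.
The search branches over all roles and adjacencies of the new vertex.

A branch dies when an induced path gets two partners, or when the revealed part stays non-polar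
after deletion of a vertex. It succeeds when the revealed part contains a listed graph, which is all
of `G` by minimality. `search_eq_true` says that every branch closes, and `search_sound` that this
is conclusive. The converse is a finite check on the thirteen adjacency matrices, and degree
sequences tell the graphs apart. -/

/-- The role of a vertex in a `(2, 1)`-polar partition: it lies in one of the two classes of the
complete multipartite part, in the clique, or it is left out of the partition. -/
inductive Role
  | one
  | two
  | clique
  | free

/-- The adjacency `a` between two vertices agrees with the roles of these vertices. -/
def compat : Role → Role → Bool → Bool
  | .one, .one, a => !a
  | .two, .two, a => !a
  | .one, .two, a => a
  | .two, .one, a => a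
  | .clique, .clique, a => a
  | _, _, _ => true

/-- A vertex of role `l` and with adjacencies `r` agrees with the roles of the other vertices. -/
def fits (l : Role) : List Role → List Bool → Bool
  | p :: ps, a :: r => compat l p a && fits l ps r
  | _, _ => true

/-- All adjacencies that a vertex of role `l` may have to vertices of given roles. -/
def rows (l : Role) : List Role → List (List Bool)
  | [] => [[]]
  | m :: ms => (rows l ms).flatMap fun r =>
      ([true, false].filter fun a => compat l m a).map fun a => a :: r

/-- The roles that a vertex may get, depending on whether it is to be left out. -/
def choices : Bool → List Role
  | true => [.free]
  | false => [.one, .two, .clique]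

/-- All assignments of roles that agree with a triangular adjacency matrix, where the vertices
marked `true` are left out. -/
def labelings : List Bool → List (List Bool) → List (List Role)
  | m :: ms, r :: T => (labelings ms T).flatMap fun p =>
      ((choices m).filter fun l => fits l p r).map fun l => l :: p
  | _, _ => [[]]

/-- The full adjacency matrix that belongs to a triangular one. -/
def toMatrix : List (List Bool) → List (List Bool)
  | [] => []
  | r :: T => (false :: r) :: List.zipWith List.cons r (toMatrix T)

/-- For a vertex with the given adjacencies to the vertices of an induced path `abcd`: it lies on
`abcd`, or on an induced path together with three of `a`, `b`, `c`, `d`. -/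
def isPartner : Bool → Bool → Bool → Bool → Bool
  | false, false, false, false => false
  | false, true, true, false => false
  | true, true, true, true => false
  | _, _, _, _ => true

/-- The number of vertices that satisfy `isPartner`, given the rows of `a`, `b`, `c`, `d`. The
recursor is used directly, here and below, because the kernel evaluates it faster. -/
noncomputable def partnerCount (A : List Bool) : List Bool → List Bool → List Bool → Nat :=
  List.rec (fun _ _ _ => 0) (fun a _ ih B C D =>
    B.rec 0 fun b B _ => C.rec 0 fun c C _ => D.rec 0 fun d D _ =>
      Bool.rec (ih B C D) (Nat.succ (ih B C D)) (isPartner a b c d)) A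

/-- Some position of `B` and `M` satisfies `f`. -/
noncomputable def any₁ (f : Bool → List Bool → Bool) (B : List Bool) : List (List Bool) → Bool :=
  List.rec (fun _ => false) (fun b _ ih M =>
    M.rec false fun r M _ => Bool.rec (ih M) true (f b r)) B

/-- Some position of `B`, `C` and `M` satisfies `f`. -/
noncomputable def any₂ (f : Bool → Bool → List Bool → Bool) (B : List Bool) :
    List Bool → List (List Bool) → Bool :=
  List.rec (fun _ _ => false) (fun b _ ih C M =>
    C.rec false fun c C _ => M.rec false fun r M _ => Bool.rec (ih C M) true (f b c r)) B

/-- Some position of `A`, `B`, `C` and `M` satisfies `f`. -/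
noncomputable def any₃ (f : Bool → Bool → Bool → List Bool → Bool) (A : List Bool) :
    List Bool → List Bool → List (List Bool) → Bool :=
  List.rec (fun _ _ _ => false) (fun a _ ih B C M =>
    B.rec false fun b B _ => C.rec false fun c C _ => M.rec false fun r M _ =>
      Bool.rec (ih B C M) true (f a b c r)) A

/-- Some induced path `abcd` has at least `k` vertices that satisfy `isPartner`. -/
noncomputable def crowded (k : Nat) (M : List (List Bool)) : Bool :=
  M.any fun B => any₁ (fun bc C => bc &&
    any₂ (fun ba ca A => ba && (!ca &&
      any₃ (fun ad bd cd D => !ad && (!bd && (cd && Nat.ble k (partnerCount A B C D))))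
        A B C M)) B C M) B M

/-- The entry in row `i` and column `j`. -/
def entry (M : List (List Bool)) (i j : Nat) : Bool :=
  (M.getD i []).getD j false

/-- The vertex `y` differs from the chosen vertices and has adjacencies `t` to them. -/
def matchesRow (M : List (List Bool)) (y : Nat) : List Nat → List Bool → Bool
  | c :: cs, a :: t => !(Nat.beq y c) && (entry M y c == a) && matchesRow M y cs t
  | [], [] => true
  | _, _ => false

/-- The chosen vertices `cs` can be extended by vertices with the adjacencies in the list. -/
def embeds (M : List (List Bool)) : List (List Bool) → List Nat → Bool
  | [], _ => true
  | t :: ts, cs => (List.range M.length).any fun y =>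
      matchesRow M y cs t && embeds M ts (y :: cs)

/-- A filter that lets `isListed` skip hopeless embeddings; soundness does not depend on it. -/
def edgeCount (T : List (List Bool)) : Nat := (T.map (List.count true)).sum

/-- For each of `E₁, …, E₁₃`, the lists of the neighbours of each vertex among the earlier ones. -/
def code : Fin 13 → List (List Nat) :=
  ![[[], [], [1], [], [3]],
    [[], [0], [1], [], [3], [4]],
    [[], [0], [1], [0, 2], [], []],
    [[], [], [0, 1], [0, 1], [0, 1, 2, 3], [0, 1, 2, 3]],
    [[], [], [0, 1], [0, 1], [0, 1, 2], [0, 1, 3]],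
    [[], [], [1], [2], [1, 3], [1, 2, 3, 4]],
    [[], [], [], [1], [1, 2, 3], [1, 2, 3]],
    [[], [0], [], [2], [2, 3], [2, 3]],
    [[], [0], [0, 1], [], [3], [3, 4]],
    [[], [0], [1], [2], [0, 3], []],
    [[], [0], [1], [0, 2], [2], []],
    [[], [], [0], [0, 1], [0, 1, 2], []],
    [[], [], [0], [0, 1], [1, 2], [0, 1, 2, 3, 4], [0, 1, 2, 3, 4]]]

/-- Triangular adjacency matrices of `E₁, …, E₁₃`, the last vertex first. -/
def target (i : Fin 13) : List (List Bool) :=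
  ((code i).zipIdx.map fun p => ((List.range p.2).map fun j => p.1.contains j).reverse).reverse

/-- The graph contains one of `E₁, …, E₁₃` with the same number of edges. -/
def isListed (T : List (List Bool)) : Bool :=
  (List.finRange 13).any fun i =>
    Nat.beq (edgeCount T) (edgeCount (target i)) && embeds (toMatrix T) (target i).reverse []

/-- The number of positions at which the roles differ or are free. -/
def distance : List Role → List Role → Nat
  | .one :: p, .one :: q => distance p q
  | .two :: p, .two :: q => distance p q
  | .clique :: p, .clique :: q => distance p q
  | _ :: p, _ :: q => (distance p q).succ
  | _, _ => 0

/-- Among `p` and the members of a list, the assignment of roles that is closest to `ls`. -/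
def closest (ls : List Role) : List (List Role) → List Role → List Role
  | [], p => p
  | q :: qs, p => bif Nat.blt (distance ls q) (distance ls p) then closest ls qs q
      else closest ls qs p

/-- Some assignment in the list extends to a vertex with adjacencies `r`. -/
def extendable (P : List (List Role)) (r : List Bool) : Bool :=
  P.any fun p => (choices false).any fun l => fits l p r

/-- All ways to mark exactly one of `n` vertices. -/
def marks : Nat → List (List Bool)
  | 0 => []
  | n + 1 => (true :: List.replicate n false) :: (marks n).map fun m => false :: m

/-- Among the vertices with the given roles and rows, the position of the first one that is not in
the clique but adjacent to all vertices in the clique. -/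
def pivot (ls : List Role) : List Role → List (List Bool) → Option Nat
  | .clique :: ms, _ :: M => (pivot ls ms M).map Nat.succ
  | _ :: ms, r :: M => bif fits .clique ls r then some 0 else (pivot ls ms M).map Nat.succ
  | _, _ => none

/-- The test for the graph obtained by adding a vertex of role `l` with adjacencies `r`, where `P`
contains the assignments of roles without this vertex, and `f` is the test to be used if there is
an assignment of roles with this vertex. -/
noncomputable def searchStep (f : List Role → List (List Bool) → Bool) (P : List (List Role))
    (ls : List Role) (T : List (List Bool)) (l : Role) (r : List Bool) : Bool :=
  bif extendable P r then
    crowded 6 (toMatrix (r :: T)) || f (l :: ls) (r :: T)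
  else
    ((marks T.length).any fun m => !extendable (labelings m T) r) ||
      (crowded 6 (toMatrix (r :: T)) || isListed (r :: T))

/-- Every minimal obstruction in which an induced path has at most one partner, and which contains
the graph with triangular adjacency matrix `T` in such a way that the roles `ls` extend to all
vertices with as many vertices in the clique as possible, is one of `E₁, …, E₁₃`. The first argument
bounds the depth of the search. -/
noncomputable def search : Nat → List Role → List (List Bool) → Bool
  | 0, _, _ => false
  | n + 1, ls, T =>
    match labelings (List.replicate T.length false) T with
    | [] => false
    | p :: ps =>
      match pivot ls ls (toMatrix T) with
      | some k => (rows .clique ls).all fun r =>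
          r.getD k false || searchStep (search n) (p :: ps) ls T .clique r
      | none => (choices false).all fun l => (rows l ls).all fun r =>
          fits l (closest ls ps p) r || searchStep (search n) (p :: ps) ls T l r

/-- The one revealed vertex at the start is the deleted vertex `v`, hence free. Depth `10` suffices
for every branch to close. -/
theorem search_eq_true : search 10 [.free] [[]] = true := by
  decide +kernel

/-! ### Polar partitions as assignments of roles -/

section

open Classical

variable {V : Type*} (G : SimpleGraph V)

/-- Each pair of distinct vertices agrees with the roles. -/
def IsLabeling (L : V → Role) : Prop :=
  ∀ u w, u ≠ w → compat (L u) (L w) (decide (G.Adj u w)) = true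

/-- The triangular adjacency matrix of a list of vertices. -/
noncomputable def triangle : List V → List (List Bool)
  | [] => []
  | x :: xs => (xs.map fun y => decide (G.Adj x y)) :: triangle xs

theorem compat_comm (l m : Role) (a : Bool) : compat l m a = compat m l a := by
  cases l <;> cases m <;> rfl

@[simp]
theorem compat_free (l : Role) (a : Bool) : compat l .free a = true := by
  cases l <;> rfl

@[simp]
theorem compat_free_left (l : Role) (a : Bool) : compat .free l a = true := rfl

theorem mem_choices_true {l : Role} : l ∈ choices true ↔ l = .free := by
  simp [choices]

theorem mem_choices_false {l : Role} : l ∈ choices false ↔ l ≠ .free := by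
  cases l <;> simp [choices]

theorem mem_choices {b : Bool} {l : Role} : l ∈ choices b ↔ (l = .free ↔ b = true) := by
  cases b
  · simp [mem_choices_false]
  · simp [mem_choices_true]

theorem isPolar_iff : IsPolar G 2 1 ↔ ∃ L : V → Role, (∀ x, L x ≠ .free) ∧ IsLabeling G L := by
  constructor
  · rintro ⟨A, ⟨c, hc⟩, ⟨d, hd⟩⟩
    refine ⟨fun x => if h : x ∈ A then (if c ⟨x, h⟩ = 0 then .one else .two) else .clique,
      fun x => ?_, fun u w huw => ?_⟩
    · dsimp only
      split_ifs <;> simp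
    · by_cases hu : u ∈ A <;> by_cases hw : w ∈ A
      · have h := hc ⟨u, hu⟩ ⟨w, hw⟩
        simp only [SimpleGraph.comap_adj, Function.Embedding.subtype_apply] at h
        simp only [hu, hw, dif_pos]
        by_cases h0 : c ⟨u, hu⟩ = 0 <;> by_cases h1 : c ⟨w, hw⟩ = 0
        · simp [h0, h1, compat, h]
        · simp [h0, h1, compat, h, Ne.symm h1]
        · simp [h0, h1, compat, h]
        · have : c ⟨u, hu⟩ = c ⟨w, hw⟩ := by omega
          simp [h1, compat, h, this]
      · simp only [hu, hw, dif_pos, dif_neg, not_false_eq_true]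
        split_ifs <;> rfl
      · simp only [hu, hw, dif_pos, dif_neg, not_false_eq_true]
        split_ifs <;> rfl
      · have h := hd ⟨u, hu⟩ ⟨w, hw⟩
        simpa [hu, hw, huw, compat, Subsingleton.elim (d ⟨u, hu⟩) (d ⟨w, hw⟩)] using h
  · rintro ⟨L, hL, h⟩
    refine ⟨{x | L x ≠ .clique}, ⟨fun x => if L x = .one then 0 else 1, ?_⟩, ⟨fun _ => 0, ?_⟩⟩
    · rintro ⟨u, hu⟩ ⟨w, hw⟩
      by_cases huw : u = w
      · subst huw
        simp
      · have h := h u w huw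
        have hfu := hL u
        have hfw := hL w
        simp only [Set.mem_ofPred_eq] at hu hw
        simp only [SimpleGraph.comap_adj, Function.Embedding.subtype_apply]
        cases hu' : L u <;> cases hw' : L w <;> simp_all [compat]
    · rintro ⟨u, hu⟩ ⟨w, hw⟩
      simp only [Set.mem_compl_iff, Set.mem_ofPred_eq, not_not] at hu hw
      by_cases huw : u = w
      · subst huw
        simp
      · have h := h u w huw
        simpa [hu, hw, huw, compat] using h

/-- A free vertex is compatible with everything, so labellings of a subgraph can live on all of `V`
and no subtype enters the search. -/
theorem isPolar_induce_iff (S : Set V) : IsPolar (G.induce S) 2 1 ↔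
    ∃ L : V → Role, (∀ x, L x = .free ↔ x ∉ S) ∧ IsLabeling G L := by
  rw [isPolar_iff]
  constructor
  · rintro ⟨L, hL, h⟩
    refine ⟨fun x => if hx : x ∈ S then L ⟨x, hx⟩ else .free, fun x => ?_, fun u w huw => ?_⟩
    · by_cases hx : x ∈ S <;> simp [hx, hL]
    · by_cases hu : u ∈ S <;> by_cases hw : w ∈ S <;> simp only [hu, hw, dif_pos, dif_neg,
        not_false_eq_true, compat_free, compat_free_left]
      simpa using h ⟨u, hu⟩ ⟨w, hw⟩ (by simpa using huw)
  · rintro ⟨L, hL, h⟩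
    refine ⟨fun x => L x, fun x => by simp [hL], fun u w huw => ?_⟩
    simpa using h u w (by simpa [Subtype.ext_iff] using huw)

variable {G}

theorem IsLabeling.isPolar_induce {L : V → Role} (h : IsLabeling G L) {S : Set V}
    (hS : ∀ x ∈ S, L x ≠ .free) : IsPolar (G.induce S) 2 1 := by
  rw [isPolar_induce_iff]
  refine ⟨fun x => if x ∈ S then L x else .free, fun x => ?_, fun u w huw => ?_⟩
  · by_cases hx : x ∈ S <;> simp [hx, hS]
  · by_cases hu : u ∈ S <;> by_cases hw : w ∈ S <;> simp [hu, hw, h u w huw]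

theorem fits_map (l : Role) (L : V → Role) (x : V) (xs : List V) :
    fits l (xs.map L) (xs.map fun y => decide (G.Adj x y)) = true ↔
      ∀ y ∈ xs, compat l (L y) (decide (G.Adj x y)) = true := by
  induction xs with
  | nil => simp [fits]
  | cons y ys ih => simp [fits, ih]

theorem map_mem_rows {l : Role} {L : V → Role} {x : V} {xs : List V}
    (h : ∀ y ∈ xs, compat l (L y) (decide (G.Adj x y)) = true) :
    (xs.map fun y => decide (G.Adj x y)) ∈ rows l (xs.map L) := by
  induction xs with
  | nil => simp [rows]
  | cons y ys ih =>
    simp only [List.map_cons, rows, List.mem_flatMap, List.mem_map, List.mem_filter]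
    refine ⟨_, ih fun z hz => h z (by simp [hz]), _, ⟨?_, h y (by simp)⟩, rfl⟩
    cases decide (G.Adj x y) <;> simp

/-- Assignments of roles to some vertices that agree with the adjacencies are found. -/
theorem map_mem_labelings {L : V → Role} {m : V → Bool} {xs : List V} (hxs : xs.Nodup)
    (hm : ∀ x ∈ xs, L x = .free ↔ m x = true)
    (h : ∀ u ∈ xs, ∀ w ∈ xs, u ≠ w → compat (L u) (L w) (decide (G.Adj u w)) = true) :
    xs.map L ∈ labelings (xs.map m) (triangle G xs) := by
  induction xs with
  | nil => simp [labelings]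
  | cons x xs ih =>
    rw [List.nodup_cons] at hxs
    simp only [List.map_cons, triangle, labelings, List.mem_flatMap, List.mem_map, List.mem_filter]
    refine ⟨_, ih hxs.2 (fun y hy => hm y (by simp [hy])) (fun u hu w hw => h u (by simp [hu]) w
      (by simp [hw])), _, ⟨mem_choices.2 (hm x (by simp)), ?_⟩, rfl⟩
    rw [fits_map]
    exact fun y hy => h x (by simp) y (by simp [hy]) (by rintro rfl; exact hxs.1 hy)

/-- Converse of `map_mem_labelings`: a computed assignment is a genuine labelling, so it can be
glued to `L` in the search and can witness polarity of the listed graphs minus a vertex. -/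
theorem exists_of_mem_labelings {m : V → Bool} {xs : List V} (hxs : xs.Nodup) {p : List Role}
    (hp : p ∈ labelings (xs.map m) (triangle G xs)) :
    ∃ L : V → Role, p = xs.map L ∧ (∀ x ∈ xs, L x = .free ↔ m x = true) ∧
      ∀ u ∈ xs, ∀ w ∈ xs, u ≠ w → compat (L u) (L w) (decide (G.Adj u w)) = true := by
  induction xs generalizing p with
  | nil => exact ⟨fun _ => .free, by simpa [labelings] using hp, by simp, by simp⟩
  | cons x xs ih =>
    rw [List.nodup_cons] at hxs
    simp only [List.map_cons, triangle, labelings, List.mem_flatMap, List.mem_map,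
      List.mem_filter] at hp
    obtain ⟨q, hq, l, ⟨hl, hf⟩, rfl⟩ := hp
    obtain ⟨L, rfl, hm, h⟩ := ih hxs.2 hq
    rw [fits_map] at hf
    have hne : ∀ y ∈ xs, y ≠ x := by
      rintro y hy rfl
      exact hxs.1 hy
    refine ⟨Function.update L x l, ?_, ?_, ?_⟩
    · simp only [List.map_cons, Function.update_self, List.cons.injEq, true_and]
      exact List.map_congr_left fun y hy => by simp [hne y hy]
    · rintro y hy
      rcases List.mem_cons.1 hy with rfl | hy
      · simpa using mem_choices.1 hl
      · simpa [hne y hy] using hm y hy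
    · intro u hu w hw huw
      rcases List.mem_cons.1 hu with rfl | hu' <;> rcases List.mem_cons.1 hw with rfl | hw'
      · exact absurd rfl huw
      · simpa [hne w hw'] using hf w hw'
      · rw [compat_comm]
        simpa [hne u hu', G.adj_comm] using hf u hu'
      · simpa [hne u hu', hne w hw'] using h u hu' w hw' huw

theorem exists_of_mem_marks {xs : List V} (hxs : xs.Nodup) {m : List Bool}
    (hm : m ∈ marks xs.length) : ∃ x ∈ xs, m = xs.map fun y => decide (y = x) := by
  induction xs generalizing m with
  | nil => simp [marks] at hm
  | cons x xs ih =>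
    rw [List.nodup_cons] at hxs
    simp only [List.length_cons, marks, List.mem_cons, List.mem_map] at hm
    rcases hm with rfl | ⟨m, hm, rfl⟩
    · refine ⟨x, by simp, ?_⟩
      simp only [List.map_cons, decide_true, List.cons.injEq, true_and]
      symm
      rw [List.eq_replicate_iff]
      simp only [List.length_map, List.mem_map, true_and]
      rintro _ ⟨y, hy, rfl⟩
      simp only [decide_eq_false_iff_not]
      rintro rfl
      exact hxs.1 hy
    · obtain ⟨y, hy, rfl⟩ := ih hxs.2 hm
      refine ⟨y, by simp [hy], ?_⟩
      simp only [List.map_cons, List.cons.injEq, and_true]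
      symm
      simp only [decide_eq_false_iff_not]
      rintro rfl
      exact hxs.1 hy

@[simp]
theorem length_triangle (xs : List V) : (triangle G xs).length = xs.length := by
  induction xs with
  | nil => rfl
  | cons x xs ih => simp [triangle, ih]

theorem toMatrix_triangle (xs : List V) :
    toMatrix (triangle G xs) = xs.map fun x => xs.map fun y => decide (G.Adj x y) := by
  induction xs with
  | nil => rfl
  | cons x xs ih =>
    simp only [triangle, toMatrix, ih, List.map_cons, SimpleGraph.irrefl, decide_false,
      List.cons.injEq, true_and, List.zipWith_map, List.zipWith_self]
    exact List.map_congr_left fun y _ => by simp [G.adj_comm]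

/-- Soundness needs only some valid assignment; taking one close to `ls` is a heuristic against
branching. -/
theorem closest_mem (ls : List Role) (ps : List (List Role)) (p : List Role) :
    closest ls ps p ∈ p :: ps := by
  induction ps generalizing p with
  | nil => simp [closest]
  | cons q qs ih =>
    rw [closest, cond_eq_ite]
    split_ifs
    · exact List.mem_cons_of_mem _ (ih q)
    · have := ih p
      simp only [List.mem_cons] at this ⊢
      tauto

end

/-! ### Induced paths -/

section

open Classical

variable {V : Type*} (G : SimpleGraph V)

/-- The vertices `a`, `b`, `c`, `d` induce a path, in this order. -/
structure IsInducedPath (a b c d : V) : Prop where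
  ab : G.Adj a b
  bc : G.Adj b c
  cd : G.Adj c d
  ac : ¬ G.Adj a c
  ad : ¬ G.Adj a d
  bd : ¬ G.Adj b d

/-- The vertex `x` satisfies `isPartner` with respect to `a`, `b`, `c`, `d`. -/
def Partner (a b c d x : V) : Prop :=
  isPartner (decide (G.Adj a x)) (decide (G.Adj b x)) (decide (G.Adj c x)) (decide (G.Adj d x))

/-- Every induced path has at most one partner. -/
def IsTidy : Prop :=
  ∀ a b c d, IsInducedPath G a b c d → ∀ x y, x ∉ ({a, b, c, d} : Set V) →
    y ∉ ({a, b, c, d} : Set V) → Partner G a b c d x → Partner G a b c d y → x = y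

variable {G}

theorem IsInducedPath.injective {a b c d : V} (h : IsInducedPath G a b c d) :
    Function.Injective ![a, b, c, d] := by
  have h1 := h.ab.ne
  have h2 := h.bc.ne
  have h3 := h.cd.ne
  have h4 : a ≠ c := by rintro rfl; exact h.ad h.cd
  have h5 : a ≠ d := by rintro rfl; exact h.ac h.cd.symm
  have h6 : b ≠ d := by rintro rfl; exact h.ad h.ab
  intro i j
  fin_cases i <;> fin_cases j <;> simp [h1, h2, h3, h4, h5, h6, h1.symm, h2.symm, h3.symm,
    h4.symm, h5.symm, h6.symm]

theorem IsInducedPath.inducesP4 {a b c d : V} (h : IsInducedPath G a b c d) :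
    InducesP4 G {a, b, c, d} := by
  have e : ({a, b, c, d} : Set V) = Set.range ![a, b, c, d] := by
    ext x
    simp [eq_comm]
    tauto
  rw [e]
  refine ⟨RelIso.symm ⟨Equiv.ofInjective _ h.injective, ?_⟩⟩
  intro i j
  have h1 := h.ac
  have h2 := h.ad
  have h3 := h.bd
  have h4 := h.ab
  have h5 := h.bc
  have h6 := h.cd
  fin_cases i <;> fin_cases j <;>
    simp [SimpleGraph.pathGraph_adj, h1, h2, h3, h4, h5, h6, h4.symm, h5.symm, h6.symm,
      G.adj_comm c a, G.adj_comm d a, G.adj_comm d b]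

theorem InducesP4.exists_isInducedPath {W : Set V} (h : InducesP4 G W) :
    ∃ a b c d, IsInducedPath G a b c d ∧ W = {a, b, c, d} := by
  obtain ⟨e⟩ := h
  have key (i j : Fin 4) : G.Adj (e.symm i) (e.symm j) ↔ (SimpleGraph.pathGraph 4).Adj i j := by
    rw [← e.symm.map_adj_iff]
    rfl
  refine ⟨e.symm 0, e.symm 1, e.symm 2, e.symm 3, ⟨?_, ?_, ?_, ?_, ?_, ?_⟩, ?_⟩
  iterate 6 simp [key, SimpleGraph.pathGraph_adj]
  ext x
  constructor
  · intro hx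
    obtain ⟨i, hi⟩ := e.symm.surjective ⟨x, hx⟩
    have : x = e.symm i := by rw [hi]
    subst this
    fin_cases i <;> simp
  · rintro (rfl | rfl | rfl | rfl) <;> exact Subtype.coe_prop _

/-- `isPartner` rejects only the patterns of an isolated vertex, a bull and a dominating vertex.
Each of the other thirteen patterns puts `x` on one of eight induced paths with three of `a`, `b`,
`c`, `d`. -/
theorem Partner.exists_isInducedPath {a b c d x : V} (h : IsInducedPath G a b c d)
    (hx : Partner G a b c d x) : ∃ p q r s, IsInducedPath G p q r s ∧ x ∈ ({p, q, r, s} : Set V) ∧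
      ({p, q, r, s} : Set V) ⊆ {x, a, b, c, d} ∧
      (({p, q, r, s} : Set V) ∩ {a, b, c, d}).Nonempty := by
  obtain ⟨h1, h2, h3, h4, h5, h6⟩ := h
  suffices IsInducedPath G x a b c ∨ IsInducedPath G x b c d ∨ IsInducedPath G x c b a ∨
      IsInducedPath G x d c b ∨ IsInducedPath G d c x a ∨ IsInducedPath G a b x d ∨
      IsInducedPath G c d x a ∨ IsInducedPath G b a x d by
    rcases this with h | h | h | h | h | h | h | h
    · exact ⟨_, _, _, _, h, by simp, by grind, ⟨a, by simp⟩⟩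
    · exact ⟨_, _, _, _, h, by simp, by grind, ⟨b, by simp⟩⟩
    · exact ⟨_, _, _, _, h, by simp, by grind, ⟨b, by simp⟩⟩
    · exact ⟨_, _, _, _, h, by simp, by grind, ⟨b, by simp⟩⟩
    · exact ⟨_, _, _, _, h, by simp, by grind, ⟨a, by simp⟩⟩
    · exact ⟨_, _, _, _, h, by simp, by grind, ⟨a, by simp⟩⟩
    · exact ⟨_, _, _, _, h, by simp, by grind, ⟨a, by simp⟩⟩
    · exact ⟨_, _, _, _, h, by simp, by grind, ⟨a, by simp⟩⟩
  have h1' := h1.symm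
  have h2' := h2.symm
  have h3' := h3.symm
  have h4' := fun h => h4 (G.adj_symm h)
  have h5' := fun h => h5 (G.adj_symm h)
  have h6' := fun h => h6 (G.adj_symm h)
  have ha := G.adj_comm x a
  have hb := G.adj_comm x b
  have hc := G.adj_comm x c
  have hd := G.adj_comm x d
  unfold Partner at hx
  by_cases xa : G.Adj a x <;> by_cases xb : G.Adj b x <;> by_cases xc : G.Adj c x <;>
    by_cases xd : G.Adj d x <;> simp only [xa, xb, xc, xd, decide_true, decide_false, isPartner,
      Bool.false_eq_true, iff_true, iff_false] at hx ha hb hc hd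
  all_goals first
    | exact Or.inl ⟨by assumption, by assumption, by assumption, by assumption, by assumption,
        by assumption⟩
    | exact Or.inr (Or.inl ⟨by assumption, by assumption, by assumption, by assumption,
        by assumption, by assumption⟩)
    | exact Or.inr (Or.inr (Or.inl ⟨by assumption, by assumption, by assumption, by assumption,
        by assumption, by assumption⟩))
    | exact Or.inr (Or.inr (Or.inr (Or.inl ⟨by assumption, by assumption, by assumption,
        by assumption, by assumption, by assumption⟩)))
    | exact Or.inr (Or.inr (Or.inr (Or.inr (Or.inl ⟨by assumption, by assumption, by assumption,
        by assumption, by assumption, by assumption⟩))))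
    | exact Or.inr (Or.inr (Or.inr (Or.inr (Or.inr (Or.inl ⟨by assumption, by assumption,
        by assumption, by assumption, by assumption, by assumption⟩)))))
    | exact Or.inr (Or.inr (Or.inr (Or.inr (Or.inr (Or.inr (Or.inl ⟨by assumption, by assumption,
        by assumption, by assumption, by assumption, by assumption⟩))))))
    | exact Or.inr (Or.inr (Or.inr (Or.inr (Or.inr (Or.inr (Or.inr ⟨by assumption, by assumption,
        by assumption, by assumption, by assumption, by assumption⟩))))))

/-- Partners lie on paths that meet `{a, b, c, d}`, so extendibility bounds their number. Tidiness
ignores paths sharing fewer than three vertices, but it is all the search uses. -/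
theorem IsP4Extendible.isTidy (hG : IsP4Extendible G) : IsTidy G := by
  intro a b c d h x y hx hy hpx hpy
  obtain ⟨_, _, _, _, h₁, hx₁, -, hx₂⟩ := hpx.exists_isInducedPath h
  obtain ⟨_, _, _, _, h₂, hy₁, -, hy₂⟩ := hpy.exists_isInducedPath h
  exact hG _ h.inducesP4 ⟨hx, _, h₁.inducesP4, hx₁, hx₂⟩ ⟨hy, _, h₂.inducesP4, hy₁, hy₂⟩

theorem IsP4Sparse.not_partner (hG : IsP4Sparse G) {a b c d x : V} (h : IsInducedPath G a b c d)
    (hx : x ∉ ({a, b, c, d} : Set V)) : ¬ Partner G a b c d x := by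
  intro hp
  obtain ⟨p, q, r, s, h₁, hx₁, hsub, -⟩ := hp.exists_isInducedPath h
  have e : ({a, b, c, d} : Set V) = {p, q, r, s} :=
    hG {x, a, b, c, d} Finset.card_le_five ⟨by simp, h.inducesP4⟩
      ⟨by simpa using hsub, h₁.inducesP4⟩
  exact hx (e ▸ hx₁)

theorem IsP4Sparse.isTidy (hG : IsP4Sparse G) : IsTidy G :=
  fun _ _ _ _ h _ _ hx _ hpx _ => absurd hpx (hG.not_partner h hx)

theorem any₁_map {f : Bool → List Bool → Bool} (b : V → Bool) (r : V → List Bool) (xs : List V) :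
    any₁ f (xs.map b) (xs.map r) = xs.any fun x => f (b x) (r x) := by
  induction xs with
  | nil => rfl
  | cons x xs ih =>
    rw [List.any_cons, ← ih]
    change @Bool.rec (fun _ => Bool) _ _ (f (b x) (r x)) = _
    cases f (b x) (r x) <;> rfl

theorem any₂_map {f : Bool → Bool → List Bool → Bool} (b c : V → Bool) (r : V → List Bool)
    (xs : List V) :
    any₂ f (xs.map b) (xs.map c) (xs.map r) = xs.any fun x => f (b x) (c x) (r x) := by
  induction xs with
  | nil => rfl
  | cons x xs ih =>
    rw [List.any_cons, ← ih]
    change @Bool.rec (fun _ => Bool) _ _ (f (b x) (c x) (r x)) = _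
    cases f (b x) (c x) (r x) <;> rfl

theorem any₃_map {f : Bool → Bool → Bool → List Bool → Bool} (a b c : V → Bool)
    (r : V → List Bool) (xs : List V) : any₃ f (xs.map a) (xs.map b) (xs.map c) (xs.map r) =
      xs.any fun x => f (a x) (b x) (c x) (r x) := by
  induction xs with
  | nil => rfl
  | cons x xs ih =>
    rw [List.any_cons, ← ih]
    change @Bool.rec (fun _ => Bool) _ _ (f (a x) (b x) (c x) (r x)) = _
    cases f (a x) (b x) (c x) (r x) <;> rfl

theorem partnerCount_map (a b c d : V → Bool) (xs : List V) :
    partnerCount (xs.map a) (xs.map b) (xs.map c) (xs.map d) =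
      xs.countP fun x => isPartner (a x) (b x) (c x) (d x) := by
  induction xs with
  | nil => rfl
  | cons x xs ih =>
    rw [List.countP_cons, ← ih]
    change @Bool.rec (fun _ => ℕ) _ _ (isPartner (a x) (b x) (c x) (d x)) = _
    cases isPartner (a x) (b x) (c x) (d x) <;> rfl

/-- A crowded graph has an induced path and many vertices that are on it or partners of it. -/
theorem exists_of_crowded {k : ℕ} {xs : List V} (hxs : xs.Nodup)
    (h : crowded k (toMatrix (triangle G xs)) = true) :
    ∃ a b c d, IsInducedPath G a b c d ∧
      ∃ s : Finset V, k ≤ s.card ∧ ∀ x ∈ s, Partner G a b c d x := by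
  rw [toMatrix_triangle, crowded] at h
  simp only [List.any_map, Function.comp_def, any₁_map, any₂_map, any₃_map, partnerCount_map,
    List.any_eq_true, Bool.and_eq_true, Bool.not_eq_true', decide_eq_true_eq, decide_eq_false_iff_not,
    Nat.ble_eq] at h
  obtain ⟨b, -, c, -, bc, a, -, ba, ca, d, -, ad, bd, cd, h⟩ := h
  refine ⟨a, b, c, d, ⟨ba.symm, bc, cd, fun h => ca h.symm, ad, bd⟩,
    (xs.filter fun x => isPartner (decide (G.Adj a x)) (decide (G.Adj b x)) (decide (G.Adj c x))
      (decide (G.Adj d x))).toFinset, ?_, ?_⟩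
  · rw [List.toFinset_card_of_nodup (hxs.filter _), ← List.countP_eq_length_filter]
    exact h
  · intro x hx
    simp only [List.mem_toFinset, List.mem_filter] at hx
    exact hx.2

/-- The vertices `a`, `b`, `c`, `d` satisfy `isPartner` themselves, so two outside partners give the
threshold `4 + 2`; in the sparse case one partner gives `4 + 1`. -/
theorem IsTidy.not_crowded (hG : IsTidy G) {xs : List V} (hxs : xs.Nodup) :
    crowded 6 (toMatrix (triangle G xs)) = false := by
  rw [Bool.eq_false_iff]
  intro h
  obtain ⟨a, b, c, d, hp, s, hs, h⟩ := exists_of_crowded hxs h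
  have h1 : 1 < (s \ {a, b, c, d}).card := by
    have := Finset.le_card_sdiff {a, b, c, d} s
    have := Finset.card_le_four (a := a) (b := b) (c := c) (d := d)
    omega
  obtain ⟨x, hx, y, hy, hne⟩ := Finset.one_lt_card.1 h1
  simp only [Finset.mem_sdiff] at hx hy
  exact hne (hG a b c d hp x y (by simpa using hx.2) (by simpa using hy.2) (h x hx.1) (h y hy.1))

theorem IsP4Sparse.not_crowded (hG : IsP4Sparse G) {xs : List V} (hxs : xs.Nodup) :
    crowded 5 (toMatrix (triangle G xs)) = false := by
  rw [Bool.eq_false_iff]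
  intro h
  obtain ⟨a, b, c, d, hp, s, hs, h⟩ := exists_of_crowded hxs h
  have h1 : 0 < (s \ {a, b, c, d}).card := by
    have := Finset.le_card_sdiff {a, b, c, d} s
    have := Finset.card_le_four (a := a) (b := b) (c := c) (d := d)
    omega
  obtain ⟨x, hx⟩ := Finset.card_pos.1 h1
  simp only [Finset.mem_sdiff] at hx
  exact hG.not_partner hp (by simpa using hx.2) (h x hx.1)

end

/-! ### Soundness of the search -/

section

open Classical

variable {V : Type*} {G : SimpleGraph V}

variable (G) in
/-- The triangular adjacency matrix of `G` is `T`, for some enumeration of the vertices. -/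
def HasTriangle (T : List (List Bool)) : Prop :=
  ∃ xs : List V, xs.Nodup ∧ (∀ v, v ∈ xs) ∧ triangle G xs = T

theorem entry_toMatrix {xs : List V} {i j : ℕ} {v w : V} (hi : xs[i]? = some v)
    (hj : xs[j]? = some w) : entry (toMatrix (triangle G xs)) i j = decide (G.Adj v w) := by
  simp [toMatrix_triangle, entry, List.getD_eq_getElem?_getD, hi, hj]

theorem matchesRow_sound {xs : List V} (hxs : xs.Nodup) {y : ℕ} {v : V} (hy : xs[y]? = some v)
    {cs : List ℕ} {ys : List V} (h : List.Forall₂ (fun i w => xs[i]? = some w) cs ys)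
    {t : List Bool} (ht : matchesRow (toMatrix (triangle G xs)) y cs t = true) :
    v ∉ ys ∧ (ys.map fun w => decide (G.Adj v w)) = t := by
  induction h generalizing t with
  | nil => cases t <;> simp_all [matchesRow]
  | @cons c w cs ys hc h ih =>
    cases t with
    | nil => simp [matchesRow] at ht
    | cons a t =>
      simp only [matchesRow, Bool.and_eq_true, Bool.not_eq_true', beq_iff_eq,
        entry_toMatrix hy hc] at ht
      obtain ⟨⟨hne, ha⟩, ht⟩ := ht
      obtain ⟨h1, h2⟩ := ih ht
      refine ⟨?_, by simp [ha, h2]⟩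
      rw [List.mem_cons, not_or]
      refine ⟨?_, h1⟩
      rintro rfl
      have hlt : y < xs.length := (List.getElem?_eq_some_iff.1 hy).1
      have : y = c := (List.getElem?_inj hlt hxs).1 (hy.trans hc.symm)
      subst this
      simp at hne

/-- The images `ys` accumulate with the newest first, as in `triangle`, so the rows `ts` come out
reversed. -/
theorem embeds_sound {xs : List V} (hxs : xs.Nodup) {ts : List (List Bool)} {cs : List ℕ}
    {ys : List V} (h : List.Forall₂ (fun i w => xs[i]? = some w) cs ys) (hys : ys.Nodup)
    (ht : embeds (toMatrix (triangle G xs)) ts cs = true) :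
    ∃ zs : List V, zs.Nodup ∧ triangle G zs = ts.reverse ++ triangle G ys := by
  induction ts generalizing cs ys with
  | nil => exact ⟨ys, hys, rfl⟩
  | cons t ts ih =>
    simp only [embeds, List.any_eq_true, List.mem_range, Bool.and_eq_true] at ht
    obtain ⟨y, hlt, hm, he⟩ := ht
    rw [toMatrix_triangle, List.length_map] at hlt
    have hy : xs[y]? = some xs[y] := List.getElem?_eq_getElem hlt
    obtain ⟨h1, h2⟩ := matchesRow_sound hxs hy h hm
    obtain ⟨zs, hzs, hz⟩ := ih (h.cons hy) (hys.cons h1) he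
    refine ⟨zs, hzs, ?_⟩
    rw [hz]
    simp [triangle, h2]

/-- A graph without assignments of roles is not polar. -/
theorem not_isPolar_induce_of_labelings {xs : List V} (hxs : xs.Nodup)
    (h : labelings (List.replicate xs.length false) (triangle G xs) = []) :
    ¬ IsPolar (G.induce {v | v ∈ xs}) 2 1 := by
  rw [isPolar_induce_iff]
  rintro ⟨L, hL, hLG⟩
  have := map_mem_labelings (m := fun _ => false) hxs (fun x hx => by simp [hL, hx])
    fun u _ w _ => hLG u w
  simp [h] at this

theorem labelings_target (i : Fin 13) :
    labelings (List.replicate (target i).length false) (target i) = [] := by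
  have : ∀ i, (labelings (List.replicate (target i).length false) (target i)).isEmpty = true := by
    decide +kernel
  simpa using this i

/-- An induced copy of a listed graph has no labelling, while proper induced subgraphs of `G` are
polar; hence the copy exhausts `G`. -/
theorem IsMinimalPolarObstruction.hasTriangle_target (hG : IsMinimalPolarObstruction G 2 1)
    {xs : List V} (hxs : xs.Nodup) {i : Fin 13} (h : triangle G xs = target i) :
    HasTriangle G (target i) := by
  refine ⟨xs, hxs, ?_, h⟩
  by_contra hne
  refine not_isPolar_induce_of_labelings hxs ?_ (hG.2 {v | v ∈ xs} ?_)
  · rw [h, ← length_triangle (G := G), h]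
    exact labelings_target i
  · exact fun h => hne (Set.eq_univ_iff_forall.1 h)

theorem isListed_sound (hG : IsMinimalPolarObstruction G 2 1) {xs : List V} (hxs : xs.Nodup)
    (h : isListed (triangle G xs) = true) : ∃ i, HasTriangle G (target i) := by
  simp only [isListed, List.any_eq_true, Bool.and_eq_true] at h
  obtain ⟨i, -, -, h⟩ := h
  obtain ⟨zs, hzs, hz⟩ := embeds_sound hxs .nil List.nodup_nil h
  exact ⟨i, hG.hasTriangle_target hzs (by simpa [triangle] using hz)⟩

theorem extendable_of_forall {m : V → Bool} {L : V → Role} {x : V} {xs : List V}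
    (hx : (x :: xs).Nodup) (hfree : L x ≠ .free) (hm : ∀ y ∈ xs, L y = .free ↔ m y = true)
    (hL : IsLabeling G L) : extendable (labelings (xs.map m) (triangle G xs))
      (xs.map fun y => decide (G.Adj x y)) = true := by
  rw [List.nodup_cons] at hx
  simp only [extendable, List.any_eq_true]
  refine ⟨_, map_mem_labelings hx.2 hm fun u _ w _ => hL u w, L x, mem_choices_false.2 hfree, ?_⟩
  rw [fits_map]
  exact fun y hy => hL x y (by rintro rfl; exact hx.1 hy)

/-- `xs` stays fixed while the recursion consumes `ys`, so each candidate is tested against the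
whole revealed clique. -/
theorem pivot_sound {L : V → Role} {xs ys : List V} {k : ℕ}
    (h : pivot (xs.map L) (ys.map L) (ys.map fun x => xs.map fun y => decide (G.Adj x y)) = some k) :
    ∃ a, ys[k]? = some a ∧ L a ≠ .clique ∧ ∀ y ∈ xs, L y = .clique → G.Adj a y := by
  induction ys generalizing k with
  | nil => simp [pivot] at h
  | cons a ys ih =>
    by_cases ha : L a = .clique
    · simp only [List.map_cons, ha, pivot, Option.map_eq_some_iff] at h
      obtain ⟨k, hk, rfl⟩ := h
      simpa using ih hk
    · have h : (bif fits .clique (xs.map L) (xs.map fun y => decide (G.Adj a y)) then some 0 else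
          (pivot (xs.map L) (ys.map L) (ys.map fun x => xs.map fun y => decide (G.Adj x y))).map
            Nat.succ) = some k := by
        cases hl : L a <;> simp_all [pivot]
      rw [cond_eq_ite] at h
      split_ifs at h with hf
      · rw [fits_map] at hf
        cases h
        exact ⟨a, rfl, ha, fun y hy hc => by simpa [hc, compat] using hf y hy⟩
      · obtain ⟨k, hk, rfl⟩ := Option.map_eq_some_iff.1 h
        simpa using ih hk

theorem searchStep_sound (hG : IsMinimalPolarObstruction G 2 1) (hT : IsTidy G) {L : V → Role}
    {f : List Role → List (List Bool) → Bool} {u : V} {xs : List V} (hu : (u :: xs).Nodup)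
    (hf : f ((u :: xs).map L) (triangle G (u :: xs)) = true → ∃ i, HasTriangle G (target i))
    (h : searchStep f (labelings (xs.map fun _ => false) (triangle G xs)) (xs.map L)
      (triangle G xs) (L u) (xs.map fun y => decide (G.Adj u y)) = true) :
    ∃ i, HasTriangle G (target i) := by
  have hxs := (List.nodup_cons.1 hu).2
  rw [searchStep, cond_eq_ite] at h
  have hc := hT.not_crowded hu
  have hl := isListed_sound hG hu
  simp only [triangle, List.map_cons] at hc hf hl
  simp only [hc, Bool.false_or] at h
  split_ifs at h with he
  · exact hf h
  · rw [Bool.or_eq_true] at h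
    rcases h with h | h
    · simp only [List.any_eq_true, length_triangle, Bool.not_eq_true'] at h
      obtain ⟨m, hm, h⟩ := h
      obtain ⟨x, hx, rfl⟩ := exists_of_mem_marks hxs hm
      -- `G - x` is polar, and a labelling of it gives `u` a genuine role; so the revealed part
      -- without `x` does extend to `u`, against `h`.
      obtain ⟨L', hfree, hL'⟩ := (isPolar_induce_iff G _).1 (hG.2 {x}ᶜ (by
        rw [Ne, Set.eq_univ_iff_forall]
        exact fun h => h x rfl))
      rw [extendable_of_forall hu (L := L') ?_ ?_ hL'] at h
      · cases h
      · rw [Ne, hfree]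
        simp only [Set.mem_compl_iff, Set.mem_singleton_iff, not_not]
        rintro rfl
        exact (List.nodup_cons.1 hu).1 hx
      · intro y _
        simp [hfree]
    · exact hl h

/-- `hmax` is what maximality of the clique provides. `hfree` gives every unrevealed vertex a
genuine role, as both the branching and the gluing require. -/
theorem search_sound (hG : IsMinimalPolarObstruction G 2 1) (hT : IsTidy G) {L : V → Role}
    (hL : IsLabeling G L)
    (hmax : ∀ a, L a ≠ .clique → ∃ u, L u = .clique ∧ ¬ G.Adj a u) (n : ℕ) {xs : List V}
    (hxs : xs.Nodup) (hfree : ∀ x, L x = .free → x ∈ xs)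
    (h : search n (xs.map L) (triangle G xs) = true) : ∃ i, HasTriangle G (target i) := by
  induction n generalizing xs with
  | zero => simp [search] at h
  | succ n ih =>
    have step : ∀ u, u ∉ xs → searchStep (search n)
        (labelings (xs.map fun _ => false) (triangle G xs)) (xs.map L) (triangle G xs) (L u)
        (xs.map fun y => decide (G.Adj u y)) = true → ∃ i, HasTriangle G (target i) := by
      intro u hu
      exact searchStep_sound hG hT (hxs.cons hu) (ih (hxs.cons hu)
        fun x hx => List.mem_cons_of_mem _ (hfree x hx))
    have hrow : ∀ u, u ∉ xs →
        (xs.map fun y => decide (G.Adj u y)) ∈ rows (L u) (xs.map L) := by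
      intro u hu
      exact map_mem_rows fun y hy => hL u y (by rintro rfl; exact hu hy)
    have e : List.replicate (triangle G xs).length false = xs.map fun _ => false := by simp
    rw [search, e] at h
    split at h
    · cases h
    · rename_i p ps hP
      rw [← hP] at h
      split at h
      · rename_i k hk
        rw [toMatrix_triangle] at hk
        obtain ⟨a, hka, ha, hadj⟩ := pivot_sound hk
        -- As `a` is adjacent to all revealed clique vertices, the clique vertex that it misses is
        -- new.
        obtain ⟨u, hu, hau⟩ := hmax a ha
        have hux : u ∉ xs := fun h => hau (hadj u h hu)
        have := hrow u hux
        rw [hu] at this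
        have h := List.all_eq_true.1 h _ this
        rw [Bool.or_eq_true, ← hu] at h
        refine step u hux (h.resolve_left ?_)
        simp [List.getD_eq_getElem?_getD, hka, G.adj_comm u a, hau]
      · have hq := closest_mem (xs.map L) ps p
        rw [← hP] at hq
        obtain ⟨L', hL'eq, hL'free, hL'⟩ := exists_of_mem_labelings hxs hq
        rw [hL'eq] at h
        -- An unrevealed vertex in conflict with `L'` would finish the proof by `step`. Without one,
        -- `L'` on `xs` and `L` elsewhere form a polar labelling of `G`.
        by_contra hcon
        refine hG.1 ((isPolar_iff G).2 ⟨fun x => if x ∈ xs then L' x else L x, fun x => ?_, ?_⟩)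
        · by_cases hx : x ∈ xs
          · simp [hx, hL'free x hx]
          · simpa [hx] using fun h => hx (hfree x h)
        · have key : ∀ u, u ∉ xs → ∀ y ∈ xs, compat (L u) (L' y) (decide (G.Adj u y)) = true := by
            intro u hu
            rw [← fits_map]
            have h := List.all_eq_true.1 (List.all_eq_true.1 h (L u)
              (mem_choices_false.2 fun h => hu (hfree u h))) _ (hrow u hu)
            rw [Bool.or_eq_true] at h
            exact h.resolve_right fun h => hcon (step u hu h)
          intro u w huw
          by_cases hu : u ∈ xs <;> by_cases hw : w ∈ xs <;>
            simp only [hu, hw, if_true, if_false]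
          · exact hL' u hu w hw huw
          · rw [compat_comm]
            simpa only [G.adj_comm] using key w hw u hu
          · exact key u hu w hw
          · exact hL u w huw

theorem IsMinimalPolarObstruction.exists_hasTriangle [Finite V]
    (hG : IsMinimalPolarObstruction G 2 1) (hT : IsTidy G) :
    ∃ i, HasTriangle G (target i) := by
  obtain ⟨v⟩ : Nonempty V := by
    by_contra hV
    rw [not_nonempty_iff] at hV
    exact hG.1 ((isPolar_iff G).2 ⟨fun _ => .one, fun x => hV.elim x, fun x => hV.elim x⟩)
  have : Finite {L : V → Role // (∀ x, L x = .free ↔ x = v) ∧ IsLabeling G L} := by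
    have : Finite Role := Finite.of_surjective (fun i : Fin 4 =>
      (![.one, .two, .clique, .free] : Fin 4 → Role) i) (by
        rintro (_ | _ | _ | _)
        exacts [⟨0, rfl⟩, ⟨1, rfl⟩, ⟨2, rfl⟩, ⟨3, rfl⟩])
    infer_instance
  have : Nonempty {L : V → Role // (∀ x, L x = .free ↔ x = v) ∧ IsLabeling G L} := by
    obtain ⟨L, hfree, hL⟩ := (isPolar_induce_iff G _).1 (hG.2 {v}ᶜ (by
      rw [Ne, Set.eq_univ_iff_forall]
      exact fun h => h v rfl))
    exact ⟨⟨L, by simpa using hfree, hL⟩⟩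
  obtain ⟨⟨L, hfree, hL⟩, hmax⟩ := Finite.exists_max
    (fun L : {L : V → Role // (∀ x, L x = .free ↔ x = v) ∧ IsLabeling G L} =>
      {x | L.1 x = .clique}.ncard)
  refine search_sound hG hT hL (fun a ha => ?_) 10 (xs := [v]) (List.nodup_singleton v)
    (by simp [hfree]) ?_
  · by_contra! hcon
    -- A vertex `a` adjacent to the whole clique can join it. For `a = v` this makes `G` polar;
    -- otherwise it contradicts maximality.
    have hL' : IsLabeling G (Function.update L a .clique) := by
      intro u w huw
      by_cases hu : u = a
      · subst hu
        rw [Function.update_self, Function.update_of_ne huw.symm]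
        cases hw : L w
        case clique => simp [compat, hcon w hw]
        all_goals rfl
      · rw [Function.update_of_ne hu]
        by_cases hw : w = a
        · subst hw
          rw [Function.update_self]
          cases hu : L u
          case clique => simp [compat, (hcon u hu).symm]
          all_goals rfl
        · rw [Function.update_of_ne hw]
          exact hL u w huw
    by_cases hav : a = v
    · refine hG.1 ((isPolar_iff G).2 ⟨_, fun x => ?_, hL'⟩)
      by_cases hx : x = a
      · simp [hx]
      · rw [Function.update_of_ne hx, Ne, hfree]
        rwa [← hav]
    · have := hmax ⟨Function.update L a .clique, fun x => ?_, hL'⟩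
      · refine absurd this (not_le.2 (Set.ncard_lt_ncard ?_ (Set.toFinite _)))
        rw [Set.ssubset_iff_of_subset]
        · exact ⟨a, by simp, ha⟩
        · intro x hx
          by_cases hxa : x = a
          · simp [hxa]
          · simpa [Function.update_of_ne hxa] using hx
      · by_cases hx : x = a
        · simp [hx, hav]
        · rw [Function.update_of_ne hx, hfree]
  · simpa [triangle, (hfree v).2 rfl] using search_eq_true

end

/-! ### The listed graphs -/

section

open Classical

variable {V W : Type*} {G : SimpleGraph V} {H : SimpleGraph W}

theorem triangle_map (e : G ≃g H) (xs : List V) : triangle H (xs.map e) = triangle G xs := by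
  induction xs with
  | nil => rfl
  | cons x xs ih => simp [triangle, ih, Function.comp_def, e.map_adj_iff]

theorem HasTriangle.map {T : List (List Bool)} (h : HasTriangle G T) (e : G ≃g H) :
    HasTriangle H T := by
  obtain ⟨xs, h1, h2, rfl⟩ := h
  exact ⟨xs.map e, h1.map e.injective, fun w => List.mem_map.2 ⟨e.symm w, h2 _, by simp⟩,
    triangle_map e xs⟩

/-- Matching the two enumerations position by position preserves adjacency. -/
theorem HasTriangle.nonempty_iso {T : List (List Bool)} (hG : HasTriangle G T)
    (hH : HasTriangle H T) : Nonempty (G ≃g H) := by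
  obtain ⟨xs, h1, h2, h3⟩ := hG
  obtain ⟨ys, k1, k2, k3⟩ := hH
  have hlen : xs.length = ys.length := by
    rw [← length_triangle (G := G), h3, ← k3, length_triangle]
  let e : V ≃ W := ((h1.getEquivOfForallMemList xs h2).symm.trans (finCongr hlen)).trans
    (k1.getEquivOfForallMemList ys k2)
  have he : ∀ i : Fin xs.length, e xs[i] = ys[(i : ℕ)] := by
    intro i
    have : (h1.getEquivOfForallMemList xs h2).symm xs[i] = i := by
      rw [Equiv.symm_apply_eq]
      rfl
    simp only [e, Equiv.trans_apply, this]
    rfl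
  refine ⟨e, ?_⟩
  intro u w
  obtain ⟨i, rfl⟩ := (h1.getEquivOfForallMemList xs h2).surjective u
  obtain ⟨j, rfl⟩ := (h1.getEquivOfForallMemList xs h2).surjective w
  simp only [List.Nodup.getEquivOfForallMemList_apply, List.get_eq_getElem]
  have hi := he i
  have hj := he j
  simp only [Fin.getElem_fin] at hi hj
  rw [hi, hj]
  have key1 := entry_toMatrix (G := G) (xs := xs) (List.getElem?_eq_getElem i.2)
    (List.getElem?_eq_getElem j.2)
  have key2 := entry_toMatrix (G := H) (xs := ys) (List.getElem?_eq_getElem (lt_of_lt_of_eq i.2 hlen))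
    (List.getElem?_eq_getElem (lt_of_lt_of_eq j.2 hlen))
  rw [h3] at key1
  rw [k3, key1] at key2
  exact (decide_eq_decide.1 key2).symm

/-- The degrees of the vertices. -/
def degrees (T : List (List Bool)) : List ℕ := (toMatrix T).map (List.count true)

theorem HasTriangle.perm_degrees {T T' : List (List Bool)} (h : HasTriangle G T)
    (h' : HasTriangle G T') : (degrees T).Perm (degrees T') := by
  obtain ⟨xs, h1, h2, rfl⟩ := h
  obtain ⟨ys, k1, k2, rfl⟩ := h'
  have hp : xs.Perm ys := (List.perm_ext_iff_of_nodup h1 k1).2 fun a => by simp [h2, k2]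
  simp only [degrees, toMatrix_triangle, List.map_map]
  have e : (List.count true ∘ fun x => xs.map fun y => decide (G.Adj x y)) =
      (List.count true ∘ fun x => ys.map fun y => decide (G.Adj x y)) :=
    funext fun x => (hp.map _).count_eq _
  rw [e]
  exact hp.map _

/-- The degree sequences of the thirteen graphs are pairwise distinct as multisets. -/
theorem HasTriangle.target_injective {i j : Fin 13} (h : HasTriangle G (target i))
    (h' : HasTriangle G (target j)) : i = j := by
  have : ∀ i j, i ≠ j → ¬ (degrees (target i)).Perm (degrees (target j)) := by
    decide +kernel
  by_contra hne
  exact this i j hne (h.perm_degrees h')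

theorem map_mem_marks {xs : List V} (hxs : xs.Nodup) {x : V} (hx : x ∈ xs) :
    (xs.map fun y => decide (y = x)) ∈ marks xs.length := by
  induction xs with
  | nil => simp at hx
  | cons z xs ih =>
    rw [List.nodup_cons] at hxs
    rw [List.length_cons, marks, List.mem_cons, List.mem_map]
    rcases List.mem_cons.1 hx with rfl | hx
    · left
      simp only [List.map_cons, decide_true, List.cons.injEq, true_and]
      rw [List.eq_replicate_iff]
      simp only [List.length_map, List.mem_map, true_and]
      rintro _ ⟨y, hy, rfl⟩
      simp only [decide_eq_false_iff_not]
      rintro rfl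
      exact hxs.1 hy
    · right
      refine ⟨_, ih hxs.2 hx, ?_⟩
      simp only [List.map_cons, List.cons.injEq, and_true]
      symm
      simp only [decide_eq_false_iff_not]
      rintro rfl
      exact hxs.1 hx

/-- Polarity passes to induced subgraphs, so it is enough to check the deletion of single vertices.
-/
theorem HasTriangle.isMinimalPolarObstruction {i : Fin 13} (h : HasTriangle G (target i)) :
    IsMinimalPolarObstruction G 2 1 := by
  obtain ⟨xs, hxs, hall, hT⟩ := h
  have hlen : xs.length = (target i).length := by rw [← hT, length_triangle]
  constructor
  · rw [isPolar_iff]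
    rintro ⟨L, hL, hLG⟩
    have := map_mem_labelings (m := fun _ => false) hxs (fun x _ => by simp [hL])
      fun u _ w _ => hLG u w
    rw [hT, List.map_const', hlen, labelings_target] at this
    simp at this
  · intro S hS
    obtain ⟨x, hx⟩ := (Set.ne_univ_iff_exists_notMem S).1 hS
    have check : ∀ i, ((marks (target i).length).all fun m =>
        !(labelings m (target i)).isEmpty) = true := by
      decide +kernel
    have hm := map_mem_marks hxs (hall x)
    rw [hlen] at hm
    have hne := List.all_eq_true.1 (check i) _ hm
    simp only [Bool.not_eq_true', List.isEmpty_eq_false_iff] at hne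
    obtain ⟨p, hp⟩ := List.exists_mem_of_ne_nil _ hne
    rw [← hT] at hp
    obtain ⟨L, -, hfree, hL⟩ := exists_of_mem_labelings hxs hp
    refine IsLabeling.isPolar_induce (L := L) (fun u w => hL u (hall u) w (hall w)) ?_
    intro y hy
    rw [Ne, hfree y (hall y), decide_eq_true_eq]
    rintro rfl
    exact hx hy

/-- Induced paths have all their vertices at positions from `m` on. -/
def pathsFrom (m : ℕ) (M : List (List Bool)) : Bool :=
  (List.range M.length).all fun a => (List.range M.length).all fun b => !entry M a b ||
    (List.range M.length).all fun c => !entry M b c || entry M a c ||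
      (List.range M.length).all fun d => !entry M c d || entry M a d || entry M b d ||
        (Nat.ble m a && Nat.ble m b && Nat.ble m c && Nat.ble m d)

theorem IsInducedPath.subset_drop {m : ℕ} {xs : List V} (hall : ∀ v, v ∈ xs)
    (hm : pathsFrom m (toMatrix (triangle G xs)) = true) {a b c d : V}
    (h : IsInducedPath G a b c d) : ({a, b, c, d} : Set V) ⊆ {v | v ∈ xs.drop m} := by
  have hlen : (toMatrix (triangle G xs)).length = xs.length := by simp [toMatrix_triangle]
  obtain ⟨a', ha', ha⟩ := List.getElem_of_mem (hall a)
  obtain ⟨b', hb', hb⟩ := List.getElem_of_mem (hall b)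
  obtain ⟨c', hc', hc⟩ := List.getElem_of_mem (hall c)
  obtain ⟨d', hd', hd⟩ := List.getElem_of_mem (hall d)
  have ha := List.getElem?_eq_some_iff.2 ⟨ha', ha⟩
  have hb := List.getElem?_eq_some_iff.2 ⟨hb', hb⟩
  have hc := List.getElem?_eq_some_iff.2 ⟨hc', hc⟩
  have hd := List.getElem?_eq_some_iff.2 ⟨hd', hd⟩
  simp only [pathsFrom, hlen, List.all_eq_true, List.mem_range, Bool.or_eq_true] at hm
  have h1 := (hm a' ha' b' hb').resolve_left (by simp [entry_toMatrix ha hb, h.ab])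
  have h2 := (h1 c' hc').resolve_left
    (by simp [entry_toMatrix hb hc, entry_toMatrix ha hc, h.bc, h.ac])
  have h3 := (h2 d' hd').resolve_left
    (by simp [entry_toMatrix hc hd, entry_toMatrix ha hd, entry_toMatrix hb hd, h.cd, h.ad, h.bd])
  simp only [Bool.and_eq_true, Nat.ble_eq] at h3
  have key : ∀ v i, xs[i]? = some v → m ≤ i → v ∈ xs.drop m := by
    intro v i hi hmi
    refine List.mem_of_getElem? (i := i - m) ?_
    rw [List.getElem?_drop, Nat.add_sub_cancel' hmi, hi]
  rintro v (rfl | rfl | rfl | rfl)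
  exacts [key _ _ ha h3.1.1.1, key _ _ hb h3.1.1.2, key _ _ hc h3.1.2, key _ _ hd h3.2]

/-- All induced paths lie within one set of five vertices, which has no room for a path and two more
vertices. -/
theorem HasTriangle.isP4Extendible {i : Fin 13} (h : HasTriangle G (target i)) :
    IsP4Extendible G := by
  obtain ⟨xs, -, hall, hT⟩ := h
  -- The codes are ordered so that these five vertices are the first ones, hence the last five
  -- entries of `xs`.
  have check : ∀ i, pathsFrom ((target i).length - 5) (toMatrix (target i)) = true := by
    decide +kernel
  have hm := check i
  rw [← hT] at hm
  rintro W hW x ⟨hx, X, hX, hxX, -⟩ y ⟨hy, Y, hY, hyY, -⟩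
  obtain ⟨a, b, c, d, hp, rfl⟩ := hW.exists_isInducedPath
  obtain ⟨_, _, _, _, hp₁, rfl⟩ := hX.exists_isInducedPath
  obtain ⟨_, _, _, _, hp₂, rfl⟩ := hY.exists_isInducedPath
  have hx' := hp₁.subset_drop hall hm hxX
  have hy' := hp₂.subset_drop hall hm hyY
  have hw' := hp.subset_drop hall hm
  by_contra hxy
  have hcard : (xs.drop ((triangle G xs).length - 5)).toFinset.card ≤ 5 := by
    refine (List.toFinset_card_le _).trans ?_
    rw [List.length_drop, length_triangle]
    omega
  have hinj := hp.injective
  have h4 : (Finset.univ.image ![a, b, c, d]).card = 4 := by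
    rw [Finset.card_image_of_injective _ hinj]
    rfl
  have e : Finset.univ.image ![a, b, c, d] = {a, b, c, d} := by
    ext v
    simp [Fin.exists_fin_succ, eq_comm]
  rw [e] at h4
  have h6 : (insert x (insert y ({a, b, c, d} : Finset V))).card = 6 := by
    rw [Finset.card_insert_of_notMem, Finset.card_insert_of_notMem, h4]
    · simpa using hy
    · simpa [hxy] using hx
  have hle := Finset.card_le_card (s := insert x (insert y ({a, b, c, d} : Finset V)))
    (t := (xs.drop ((triangle G xs).length - 5)).toFinset) (by
      intro v hv
      rw [List.mem_toFinset]
      rw [Finset.mem_insert, Finset.mem_insert] at hv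
      rcases hv with rfl | rfl | hv
      · exact hx'
      · exact hy'
      · exact hw' (by simpa using hv))
  omega

/-- The first nine graphs are cographs: no position reaches the length of the list, so this instance
of `pathsFrom` excludes every induced path. -/
theorem HasTriangle.isP4Sparse {i : Fin 13} (h : HasTriangle G (target i)) (hi : i.val < 9) :
    IsP4Sparse G := by
  obtain ⟨xs, -, hall, hT⟩ := h
  have check : ∀ i : Fin 13, i.val < 9 →
      pathsFrom (target i).length (toMatrix (target i)) = true := by
    decide +kernel
  have hm := check i hi
  rw [← hT] at hm
  rintro U - W ⟨-, hW⟩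
  obtain ⟨a, b, c, d, hp, rfl⟩ := hW.exists_isInducedPath
  have ha := hp.subset_drop hall hm (Set.mem_insert a _)
  simp at ha

/-- Each of the last four graphs has an induced path with a partner. -/
theorem HasTriangle.lt_of_isP4Sparse {i : Fin 13} (h : HasTriangle G (target i))
    (hG : IsP4Sparse G) : i.val < 9 := by
  obtain ⟨xs, hxs, -, hT⟩ := h
  have check : ∀ i : Fin 13, 9 ≤ i.val → crowded 5 (toMatrix (target i)) = true := by
    decide +kernel
  by_contra hi
  have := hG.not_crowded hxs
  rw [hT, check i (not_lt.1 hi)] at this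
  cases this

end

/-! ### Vertex enumerations of the concrete graphs, in the reverse of the order used in `code`. -/

theorem hasTriangle_E1 : HasTriangle E1 (target 0) := by
  refine ⟨[.inr (.inr 1), .inr (.inr 0), .inr (.inl 1), .inr (.inl 0), .inl 0],
    by decide, by simp [Sum.forall, Fin.forall_fin_succ], ?_⟩
  simp [triangle, target, code, E1]
  decide

theorem hasTriangle_E2 : HasTriangle E2 (target 1) := by
  refine ⟨[.inr 2, .inr 1, .inr 0, .inl 2, .inl 1, .inl 0],
    by decide, by simp [Sum.forall, Fin.forall_fin_succ], ?_⟩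
  simp [triangle, target, code, E2, SimpleGraph.pathGraph_adj]
  decide

theorem hasTriangle_E3 : HasTriangle E3 (target 2) := by
  refine ⟨[.inr 1, .inr 0, .inl 3, .inl 2, .inl 1, .inl 0],
    by decide, by simp [Sum.forall, Fin.forall_fin_succ], ?_⟩
  simp [triangle, target, code, E3, SimpleGraph.cycleGraph_adj]
  decide

theorem hasTriangle_E4 : HasTriangle E4 (target 3) := by
  refine ⟨[.inr (.inr 1), .inr (.inr 0), .inr (.inl 1), .inr (.inl 0), .inl 1, .inl 0],
    by decide, by simp [Sum.forall, Fin.forall_fin_succ], ?_⟩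
  simp [triangle, target, code, E4]
  decide

theorem hasTriangle_E5 : HasTriangle E5 (target 4) := by
  refine ⟨[.inr 3, .inr 2, .inr 1, .inr 0, .inl 1, .inl 0],
    by decide, by simp [Sum.forall, Fin.forall_fin_succ], ?_⟩
  simp [triangle, target, code, E5, SimpleGraph.cycleGraph_adj]
  decide

theorem hasTriangle_E6 : HasTriangle E6 (target 5) := by
  refine ⟨[.inr (.inr 0), .inr (.inl 3), .inr (.inl 2), .inr (.inl 1), .inr (.inl 0), .inl 0],
    by decide, by simp [Sum.forall, Fin.forall_fin_succ], ?_⟩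
  simp [triangle, target, code, join, E6, SimpleGraph.cycleGraph_adj]
  decide

theorem hasTriangle_E7 : HasTriangle E7 (target 6) := by
  refine ⟨[.inr (.inr 1), .inr (.inr 0), .inr (.inl 2), .inr (.inl 1), .inr (.inl 0), .inl 0],
    by decide, by simp [Sum.forall, Fin.forall_fin_succ], ?_⟩
  simp [triangle, target, code, E7, SimpleGraph.pathGraph_adj]
  decide

theorem hasTriangle_E8 : HasTriangle E8 (target 7) := by
  refine ⟨[.inr (.inr 1), .inr (.inr 0), .inr (.inl 1), .inr (.inl 0), .inl 1, .inl 0],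
    by decide, by simp [Sum.forall, Fin.forall_fin_succ], ?_⟩
  simp [triangle, target, code, join, E8]
  decide

theorem hasTriangle_E9 : HasTriangle E9 (target 8) := by
  refine ⟨[.inr 2, .inr 1, .inr 0, .inl 2, .inl 1, .inl 0],
    by decide, by simp [Sum.forall, Fin.forall_fin_succ], ?_⟩
  simp [triangle, target, code, E9]
  decide

/-- From here on, the five-vertex summand that carries the induced paths comes first in the code, as
`HasTriangle.isP4Extendible` requires. -/
theorem hasTriangle_E10 : HasTriangle E10 (target 9) := by
  refine ⟨[.inl 0, .inr 4, .inr 3, .inr 2, .inr 1, .inr 0],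
    by decide, by simp [Sum.forall, Fin.forall_fin_succ], ?_⟩
  simp [triangle, target, code, E10, SimpleGraph.cycleGraph_adj]
  decide

theorem hasTriangle_E11 : HasTriangle E11 (target 10) := by
  refine ⟨[.inl 0, .inr 4, .inr 3, .inr 2, .inr 1, .inr 0],
    by decide, by simp [Sum.forall, Fin.forall_fin_succ], ?_⟩
  simp [triangle, target, code, banner, E11]
  decide

theorem hasTriangle_E12 : HasTriangle E12 (target 11) := by
  refine ⟨[.inl 0, .inr 4, .inr 3, .inr 2, .inr 1, .inr 0],
    by decide, by simp [Sum.forall, Fin.forall_fin_succ], ?_⟩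
  simp [triangle, target, code, E12, SimpleGraph.pathGraph_adj]
  decide

theorem hasTriangle_E13 : HasTriangle E13 (target 12) := by
  refine ⟨[.inl 1, .inl 0, .inr 4, .inr 3, .inr 2, .inr 1, .inr 0],
    by decide, by simp [Sum.forall, Fin.forall_fin_succ], ?_⟩
  simp [triangle, target, code, E13, SimpleGraph.cycleGraph_adj]
  decide

theorem hasTriangle_E (i : Fin 13) : HasTriangle (E i).2 (target i) := by
  fin_cases i
  exacts [hasTriangle_E1, hasTriangle_E2, hasTriangle_E3, hasTriangle_E4, hasTriangle_E5,
    hasTriangle_E6, hasTriangle_E7, hasTriangle_E8, hasTriangle_E9, hasTriangle_E10,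
    hasTriangle_E11, hasTriangle_E12, hasTriangle_E13]

theorem nonempty_iso_E_iff {V : Type*} {G : SimpleGraph V} {i : Fin 13} :
    Nonempty (G ≃g (E i).2) ↔ HasTriangle G (target i) :=
  ⟨fun ⟨e⟩ => (hasTriangle_E i).map e.symm, fun h => h.nonempty_iso (hasTriangle_E i)⟩

end PolarObstruction

theorem mainTheorem12 :
    -- the thirteen graphs are pairwise non-isomorphic
    (∀ i j : Fin 13, i ≠ j →
      IsEmpty ((PolarObstruction.E i).2 ≃g (PolarObstruction.E j).2)) ∧
    -- a finite graph is a `P₄`-extendible minimal obstruction iff it is one of `E₁, …, E₁₃`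
    (∀ (V : Type*) [Finite V] (G : SimpleGraph V),
      (PolarObstruction.IsP4Extendible G ∧ PolarObstruction.IsMinimalPolarObstruction G 2 1) ↔
        ∃ i : Fin 13, Nonempty (G ≃g (PolarObstruction.E i).2)) ∧
    -- a finite graph is a `P₄`-sparse minimal obstruction iff it is one of `E₁, …, E₉`
    (∀ (V : Type*) [Finite V] (G : SimpleGraph V),
      (PolarObstruction.IsP4Sparse G ∧ PolarObstruction.IsMinimalPolarObstruction G 2 1) ↔
        ∃ i : Fin 13, i.val < 9 ∧ Nonempty (G ≃g (PolarObstruction.E i).2)) := by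
  simp only [PolarObstruction.nonempty_iso_E_iff]
  refine ⟨fun i j hij => ⟨fun e => hij ?_⟩, fun V _ G => ⟨fun ⟨h, hG⟩ => ?_, fun ⟨i, h⟩ => ?_⟩,
    fun V _ G => ⟨fun ⟨h, hG⟩ => ?_, fun ⟨i, hi, h⟩ => ?_⟩⟩
  · exact ((PolarObstruction.hasTriangle_E i).map e).target_injective
      (PolarObstruction.hasTriangle_E j)
  · exact hG.exists_hasTriangle h.isTidy
  · exact ⟨h.isP4Extendible, h.isMinimalPolarObstruction⟩
  · obtain ⟨i, hi⟩ := hG.exists_hasTriangle h.isTidy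
    exact ⟨i, hi.lt_of_isP4Sparse h, hi⟩
  · exact ⟨h.isP4Sparse hi, h.isMinimalPolarObstruction⟩
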